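/- A timed I/O transition system (TIOTS) $\mathcal P=\langle I,O,S,s^0,\to\rangle$ has disjoint sets $I,O$ of input and output actions (alphabet $A=I\cup O$; timed actions $tA=I\uplus O\uplus\mathbb R^{>0}$), states $S=P\uplus\{\bot,\top\}$ ($P$ is the set of plain states), an initial state $s^0\in S$ and transitions ${\to}\subseteq S\times tA\times S$, where the transitions leaving $\top$ are exactly the self-loops labelled by all $d\in\mathbb R^{>0}$ and those leaving $\bot$ are exactly the self-loops labelled by all $\alpha\in tA$. It is time-additive if, for every plain $p$ and $d_1,d_2>0$, $p\xrightarrow{d_1+d_2}s'$ iff $p\xrightarrow{d_1}s\xrightarrow{d_2}s'$ for some $s$; deterministic if $s\xrightarrow{\alpha}s'$ and $s\xrightarrow{\alpha}s''$ imply $s'=s''$; and $\bot$-free if $\bot$ is not reachable from $s^0$. Its completion is obtained by first adding $p\xrightarrow{a}\bot$ for every plain $p$ and every $a\in I$ not enabled at $p$, and then $p\xrightarrow{\alpha}\top$ for every plain $p$ and every $\alpha\in O\uplus\mathbb R^{>0}$ not enabled at $p$. Composability of $\mathcal P_0,\mathcal P_1$ (with $A_i=I_i\cup O_i$) means: for $\parallel$,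 $O_0\cap O_1=\emptyset$; for $\wedge$ and $\vee$, $I_0=I_1$ and $O_0=O_1$; for $\%$, $A_1\subseteq A_0$, $O_1\subseteq O_0$ and $\mathcal P_1$ is deterministic. For $\otimes\in\{\parallel,\wedge,\vee,\%\}$ and composable $\mathcal P_0,\mathcal P_1$, first replace both by their completions. Then $\mathcal P_0\otimes\mathcal P_1$ has alphabets $I=(I_0\cup I_1)\setminus O$, $O=O_0\cup O_1$ for $\parallel$; $I=I_0$, $O=O_0$ for $\wedge,\vee$; $I=I_0\cup O_1$, $O=O_0\setminus O_1$ for $\%$. Its plain states are $(P_0\times P_1)\uplus P_0\uplus P_1$, its initial state is $s^0_0\otimes s^0_1$, and its transitions from plain states are those of the two completed operands on $P_0$ and on $P_1$ together with, for plain $p_i\in P_i$: $(p_0,p_1)\xrightarrow{\alpha}s_0\otimes s_1$ if $p_i\xrightarrow{\alpha}_i s_i$ for $i=0,1$; $(p_0,p_1)\xrightarrow{a}s_0\otimes p_1$ if $p_0\xrightarrow{a}_0 s_0$ and $a\notin A_1$; and $(p_0,p_1)\xrightarrow{a}p_0\otimes s_1$ if $p_1\xrightarrow{a}_1 s_1$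 and $a\notin A_0$. Here $p_0\otimes p_1=(p_0,p_1)$ for plain states, and otherwise (with $s$ an arbitrary state): - $\top\parallel s=s\parallel\top=\top$; $\bot\parallel s=s\parallel\bot=\bot$ for $s\ne\top$. - $\top\wedge s=s\wedge\top=\top$; $\bot\wedge s=s\wedge\bot=s$. - $\bot\vee s=s\vee\bot=\bot$; $\top\vee s=s\vee\top=s$. - $s\,\%\,\top=\bot$; $\bot\,\%\,s=\bot$; $\top\,\%\,s=\top$ for $s\neq\top$; $p_0\,\%\,\bot=\top$ for plain $p_0$. For TIOTSs $\mathcal P,\mathcal P'$ write $\mathcal P\sqsubseteq\mathcal P'$ if they have the same inputs and the same outputs and, for every time-additive TIOTS $\mathcal Q$ with $I_{\mathcal Q}=O_{\mathcal P}$ and $O_{\mathcal Q}=I_{\mathcal P}$, if $\mathcal P\parallel\mathcal Q$ is $\bot$-free then so is $\mathcal P'\parallel\mathcal Q$. Substitutive equivalence $\mathcal P\simeq\mathcal P'$ means $\mathcal P\sqsubseteq\mathcal P'$ and $\mathcal P'\sqsubseteq\mathcal P$. **Theorem.** $\simeq$ is a congruence with respect to $\parallel,\vee,\wedge,\%$: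 it is an equivalence relation, and for every $\otimes\in\{\parallel,\vee,\wedge,\%\}$ and all time-additive TIOTSs $\mathcal P_0\simeq\mathcal P_0'$ and $\mathcal P_1\simeq\mathcal P_1'$ such that $\mathcal P_0,\mathcal P_1$ are composable and $\mathcal P_0',\mathcal P_1'$ are composable under $\otimes$, one has $\mathcal P_0\otimes\mathcal P_1\simeq\mathcal P_0'\otimes\mathcal P_1'$. -/

import Mathlib

universe u v

/-- Timed actions over a universe `Act` of action names: an action, or a delay `d > 0`. -/
inductive TimedAction (Act : Type v) : Type v
  | act (a : Act) : TimedAction Act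
  | delay (d : {d : ℝ // 0 < d}) : TimedAction Act

/-- The states `P ⊎ {⊥, ⊤}`: plain states, the inconsistent state `bot`, the timestop `top`. -/
inductive TState (P : Type u) : Type u
  | top : TState P
  | bot : TState P
  | plain (p : P) : TState P

/-- Timed I/O transition systems. Only the transitions that leave plain states are data: those
that leave `⊤` and `⊥` are prescribed, see `TIOTS.Tr`. -/
structure TIOTS (Act : Type v) where
  /-- input actions -/
  I : Set Act
  /-- output actions -/
  O : Set Act
  disj : Disjoint I O
  /-- plain states -/
  P : Type u
  init : TState P
  /-- transitions leaving plain states -/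
  step : P → TimedAction Act → TState P → Prop
  mem_of_step : ∀ {p a s}, step p (TimedAction.act a) s → a ∈ I ∪ O

namespace TIOTS

variable {Act : Type v}

/-- The alphabet `A = I ∪ O`. -/
def A (X : TIOTS.{u, v} Act) : Set Act := X.I ∪ X.O

/-- The timed alphabet `tA = I ⊎ O ⊎ ℝ>0`. -/
def tA (X : TIOTS.{u, v} Act) : Set (TimedAction Act) :=
  {α | ∀ a, α = TimedAction.act a → a ∈ X.A}

/-- The timed outputs `tO = O ⊎ ℝ>0`. -/
def tO (X : TIOTS.{u, v} Act) : Set (TimedAction Act) :=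
  {α | ∀ a, α = TimedAction.act a → a ∈ X.O}

/-- The full transition relation. `⊤` is quiescent (exactly the delay self-loops) and `⊥` is
chaotic (exactly one self-loop for each timed action in `tA`). -/
inductive Tr (X : TIOTS.{u, v} Act) : TState X.P → TimedAction Act → TState X.P → Prop
  | top (d : {d : ℝ // 0 < d}) : Tr X TState.top (TimedAction.delay d) TState.top
  | bot (α : TimedAction Act) (h : α ∈ X.tA) : Tr X TState.bot α TState.bot
  | plain (p : X.P) (α : TimedAction Act) (s : TState X.P) (h : X.step p α s) :
      Tr X (TState.plain p) α s

/-- `p --(d₁+d₂)--> s'` iff `p --d₁--> s` and `s --d₂--> s'` for some `s`. -/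
def TimeAdditive (X : TIOTS.{u, v} Act) : Prop :=
  ∀ (p : X.P) (d₁ d₂ : {d : ℝ // 0 < d}) (s' : TState X.P),
    X.Tr (TState.plain p) (TimedAction.delay (d₁ + d₂)) s' ↔
      ∃ s, X.Tr (TState.plain p) (TimedAction.delay d₁) s ∧ X.Tr s (TimedAction.delay d₂) s'

/-- There are no ambiguous transitions. -/
def Deterministic (X : TIOTS.{u, v} Act) : Prop :=
  ∀ (s : TState X.P) (α : TimedAction Act) (s' s'' : TState X.P),
    X.Tr s α s' → X.Tr s α s'' → s' = s''

/-- `⊥` is not reachable from the initial state. -/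
def BotFree (X : TIOTS.{u, v} Act) : Prop :=
  ¬ Relation.ReflTransGen (fun s s' => ∃ α, X.Tr s α s') X.init TState.bot

/-- `α` is enabled at the plain state `p`. -/
def Enabled (X : TIOTS.{u, v} Act) (p : X.P) (α : TimedAction Act) : Prop := ∃ s, X.step p α s

/-- The `⊥`-completion: an input that is not enabled at a plain state leads to `⊥`. -/
def botCompletion (X : TIOTS.{u, v} Act) : TIOTS.{u, v} Act where
  I := X.I
  O := X.O
  disj := X.disj
  P := X.P
  init := X.init
  step p α s := X.step p α s ∨
    (s = TState.bot ∧ (∃ a ∈ X.I, α = TimedAction.act a) ∧ ¬ X.Enabled p α)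
  mem_of_step := by
    rintro p a s (h | ⟨_, ⟨b, hb, hab⟩, _⟩)
    · exact X.mem_of_step h
    · cases hab
      exact Or.inl hb

/-- The `⊤`-completion: an output or a delay that is not enabled at a plain state leads to `⊤`. -/
def topCompletion (X : TIOTS.{u, v} Act) : TIOTS.{u, v} Act where
  I := X.I
  O := X.O
  disj := X.disj
  P := X.P
  init := X.init
  step p α s := X.step p α s ∨ (s = TState.top ∧ α ∈ X.tO ∧ ¬ X.Enabled p α)
  mem_of_step := by
    rintro p a s (h | ⟨_, h, _⟩)
    · exact X.mem_of_step h
    · exact Or.inr (h a rfl)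

/-- The system completed with respect to both `⊥` and `⊤`. -/
def completion (X : TIOTS.{u, v} Act) : TIOTS.{u, v} Act := X.botCompletion.topCompletion

/-- The four composition operators: parallel composition, conjunction, disjunction, quotient. -/
inductive Op : Type
  | par
  | conj
  | disj
  | quot

/-- The composability restrictions of the operators. -/
def Composable : Op → TIOTS.{u, v} Act → TIOTS.{u, v} Act → Prop
  | Op.par, X, Y => Disjoint X.O Y.O
  | Op.conj, X, Y => X.I = Y.I ∧ X.O = Y.O
  | Op.disj, X, Y => X.I = Y.I ∧ X.O = Y.O
  | Op.quot, X, Y => Y.A ⊆ X.A ∧ Y.O ⊆ X.O ∧ Y.Deterministic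

/-- Inputs of the composition. -/
def compI : Op → TIOTS.{u, v} Act → TIOTS.{u, v} Act → Set Act
  | Op.par, X, Y => (X.I ∪ Y.I) \ (X.O ∪ Y.O)
  | Op.conj, X, _ => X.I
  | Op.disj, X, _ => X.I
  | Op.quot, X, Y => X.I ∪ Y.O

/-- Outputs of the composition. -/
def compO : Op → TIOTS.{u, v} Act → TIOTS.{u, v} Act → Set Act
  | Op.par, X, Y => X.O ∪ Y.O
  | Op.conj, X, _ => X.O
  | Op.disj, X, _ => X.O
  | Op.quot, X, Y => X.O \ Y.O

/-- The plain states `P₀ × P₁ ⊎ P₀ ⊎ P₁` of a composition. -/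
inductive CompState (P₀ P₁ : Type u) : Type u
  | pair (p₀ : P₀) (p₁ : P₁) : CompState P₀ P₁
  | left (p₀ : P₀) : CompState P₀ P₁
  | right (p₁ : P₁) : CompState P₀ P₁

/-- A state of the left component as a state of the composition. -/
def inLeft {P₀ P₁ : Type u} : TState P₀ → TState (CompState P₀ P₁)
  | TState.top => TState.top
  | TState.bot => TState.bot
  | TState.plain p => TState.plain (CompState.left p)

/-- A state of the right component as a state of the composition. -/
def inRight {P₀ P₁ : Type u} : TState P₁ → TState (CompState P₀ P₁)
  | TState.top => TState.top
  | TState.bot => TState.bot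
  | TState.plain p => TState.plain (CompState.right p)

/-- The combination `s₀ ⊗ s₁` of a state of the left and a state of the right component. -/
def combine {P₀ P₁ : Type u} : Op → TState P₀ → TState P₁ → TState (CompState P₀ P₁)
  -- parallel composition
  | Op.par, TState.top, _ => TState.top
  | Op.par, _, TState.top => TState.top
  | Op.par, TState.bot, _ => TState.bot
  | Op.par, _, TState.bot => TState.bot
  | Op.par, TState.plain p₀, TState.plain p₁ => TState.plain (CompState.pair p₀ p₁)
  -- conjunction
  | Op.conj, TState.top, _ => TState.top
  | Op.conj, _, TState.top => TState.top
  | Op.conj, TState.bot, s₁ => inRight s₁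
  | Op.conj, s₀, TState.bot => inLeft s₀
  | Op.conj, TState.plain p₀, TState.plain p₁ => TState.plain (CompState.pair p₀ p₁)
  -- disjunction
  | Op.disj, TState.bot, _ => TState.bot
  | Op.disj, _, TState.bot => TState.bot
  | Op.disj, TState.top, s₁ => inRight s₁
  | Op.disj, s₀, TState.top => inLeft s₀
  | Op.disj, TState.plain p₀, TState.plain p₁ => TState.plain (CompState.pair p₀ p₁)
  -- quotient
  | Op.quot, _, TState.top => TState.bot
  | Op.quot, TState.bot, _ => TState.bot
  | Op.quot, TState.top, _ => TState.top
  | Op.quot, TState.plain _, TState.bot => TState.top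
  | Op.quot, TState.plain p₀, TState.plain p₁ => TState.plain (CompState.pair p₀ p₁)

/-- The transitions of the composition of `X` and `Y` that leave plain states: the smallest
relation that contains those of `X` and of `Y`, synchronises the components on common timed
actions, and interleaves the actions that only one component has. -/
inductive CompStep (op : Op) (X Y : TIOTS.{u, v} Act) :
    CompState X.P Y.P → TimedAction Act → TState (CompState X.P Y.P) → Prop
  | left {p₀ α s₀} : X.step p₀ α s₀ → CompStep op X Y (CompState.left p₀) α (inLeft s₀)
  | right {p₁ α s₁} : Y.step p₁ α s₁ → CompStep op X Y (CompState.right p₁) α (inRight s₁)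
  | sync {p₀ p₁ α s₀ s₁} : X.step p₀ α s₀ → Y.step p₁ α s₁ →
      CompStep op X Y (CompState.pair p₀ p₁) α (combine op s₀ s₁)
  | actLeft {p₀ p₁ a s₀} : X.step p₀ (TimedAction.act a) s₀ → a ∉ Y.A →
      CompStep op X Y (CompState.pair p₀ p₁) (TimedAction.act a)
        (combine op s₀ (TState.plain p₁))
  | actRight {p₀ p₁ a s₁} : Y.step p₁ (TimedAction.act a) s₁ → a ∉ X.A →
      CompStep op X Y (CompState.pair p₀ p₁) (TimedAction.act a)
        (combine op (TState.plain p₀) s₁)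

theorem compI_disjoint_compO (op : Op) (X Y : TIOTS.{u, v} Act) :
    Disjoint (compI op X Y) (compO op X Y) := by
  have hX := Set.disjoint_left.1 X.disj
  cases op
  · exact Set.disjoint_sdiff_left
  · exact X.disj
  · exact X.disj
  · refine Set.disjoint_left.2 ?_
    rintro a (ha | ha) ⟨h1, h2⟩
    · exact hX ha h1
    · exact h2 ha

theorem mem_comp_of_mem (op : Op) (X Y : TIOTS.{u, v} Act) (h : Composable op X Y) (a : Act)
    (ha : a ∈ X.A ∨ a ∈ Y.A) : a ∈ compI op X Y ∪ compO op X Y := by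
  cases op
  · simp only [A, compI, compO, Set.mem_union, Set.mem_sdiff] at *
    tauto
  · obtain ⟨h1, h2⟩ := h
    simp only [A, compI, compO, Set.mem_union, ← h1, ← h2] at *
    tauto
  · obtain ⟨h1, h2⟩ := h
    simp only [A, compI, compO, Set.mem_union, ← h1, ← h2] at *
    tauto
  · obtain ⟨h1, h2, -⟩ := h
    have h3 : a ∈ X.A := ha.elim id fun h => h1 h
    simp only [A, compI, compO, Set.mem_union, Set.mem_sdiff] at *
    tauto

theorem mem_of_compStep (op : Op) (X Y : TIOTS.{u, v} Act) {p : CompState X.P Y.P} {a : Act}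
    {s : TState (CompState X.P Y.P)} (hs : CompStep op X Y p (TimedAction.act a) s) :
    a ∈ X.A ∨ a ∈ Y.A := by
  cases hs with
  | left h0 => exact Or.inl (X.mem_of_step h0)
  | right h1 => exact Or.inr (Y.mem_of_step h1)
  | sync h0 _ => exact Or.inl (X.mem_of_step h0)
  | actLeft h0 _ => exact Or.inl (X.mem_of_step h0)
  | actRight h1 _ => exact Or.inr (Y.mem_of_step h1)

/-- The composition `X ⊗ Y` of composable systems. The operands are completed first. -/
def comp (op : Op) (X Y : TIOTS.{u, v} Act) (h : Composable op X Y) : TIOTS.{u, v} Act where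
  I := compI op X Y
  O := compO op X Y
  disj := compI_disjoint_compO op X Y
  P := CompState X.completion.P Y.completion.P
  init := combine op X.completion.init Y.completion.init
  step := CompStep op X.completion Y.completion
  mem_of_step hs := mem_comp_of_mem op X Y h _ (mem_of_compStep op X.completion Y.completion hs)

/-- `E` is an environment for `X`: a time-additive system with the complementary alphabet. -/
structure IsEnvironment (E X : TIOTS.{u, v} Act) : Prop where
  additive : E.TimeAdditive
  I_eq : X.I = E.O
  O_eq : X.O = E.I

theorem IsEnvironment.composable {E X : TIOTS.{u, v} Act} (h : IsEnvironment E X) :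
    Composable Op.par X E := by
  have h1 := X.disj
  rw [h.I_eq] at h1
  exact h1.symm

/-- `Refines X Y`, written `X ⊑ Y`: the systems `X` (specification) and `Y` (implementation) have
identical alphabets, and for every environment `E`, if `X ∥ E` is `⊥`-free then so is `Y ∥ E`. -/
def Refines (X Y : TIOTS.{u, v} Act) : Prop :=
  (X.I = Y.I ∧ X.O = Y.O) ∧
    ∀ (E : TIOTS.{u, v} Act) (hX : IsEnvironment E X) (hY : IsEnvironment E Y),
      (comp Op.par X E hX.composable).BotFree → (comp Op.par Y E hY.composable).BotFree

/-- Substitutive equivalence `X ≃ Y`. -/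
def SubstEquiv (X Y : TIOTS.{u, v} Act) : Prop := Refines X Y ∧ Refines Y X

end TIOTS

/-!
Nothing about a system matters to an environment except two sets of words: those that can lead its
completion to `⊥`, and those that can lead it to a state other than `⊤` (`TIOTS.Admits`, with
`b = false` and `b = true`). Indeed `X ∥ E` is `⊥`-free unless some word lies in the first set of
one of them and in the second set of the other (`TIOTS.botFree_iff`). Hence systems with equal
alphabets and equal sets of words are equivalent, whether or not they are time-additive.

Conversely, equivalent time-additive systems have the same sets of words (`TIOTS.Refines.admits`).
An environment may go to `⊤` on any input and refuse any output or delay, so it can follow a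
single word and nothing else; it detects that this word leads the system to `⊥`, or, if it fails
at the end of the word, that it leads to a state other than `⊤`. As environments have to be
time-additive, they follow the word up to the division of its delays only, and this is
where the time additivity of the system is needed (`TIOTS.TimeAdditive.admits_remaining`).

It remains to see that the two sets of words of a composition depend only on those of the operands.
For conjunction and disjunction they are intersections and unions (`TIOTS.admits_conj`,
`TIOTS.admits_disj`); for the parallel composition and the quotient, one looks at the prefix at
which the composition first leaves the pairs of plain states (`TIOTS.admits_par`,
`TIOTS.admits_quot`). All of this is proved by induction on the word, for arbitrary starting
states `combine op s₀ s₁`. In the quotient, the words that lead the right operand to `⊤`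
also matter; they are the complement of its second set because that operand is deterministic.
-/

namespace TIOTS

variable {Act : Type v}

/-! ### Words and what they can lead to -/

/-- The states of interest at the end of a word: `⊥` if `b = false`, every state but `⊤` if
`b = true`. -/
def Final {P : Type u} (b : Bool) : TState P → Prop
  | TState.top => False
  | TState.bot => True
  | TState.plain _ => b = true

/-- `X.Admits b s w`: some run of `X` from `s` that reads the word `w` ends in `⊥` (for
`b = false`), respectively in a state other than `⊤` (for `b = true`). -/
def Admits (X : TIOTS.{u, v} Act) (b : Bool) : TState X.P → List (TimedAction Act) → Prop
  | s, [] => Final b s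
  | s, α :: w => ∃ t, X.Tr s α t ∧ X.Admits b t w

section Words

variable {X : TIOTS.{u, v} Act}

theorem Tr.mem_tA {s t : TState X.P} {α : TimedAction Act} (h : X.Tr s α t) : α ∈ X.tA := by
  cases h with
  | top d => intro a ha; cases ha
  | bot α h => exact h
  | plain p α s h =>
    rintro a rfl
    exact X.mem_of_step h

theorem tr_plain {p : X.P} {α : TimedAction Act} {t : TState X.P} :
    X.Tr (TState.plain p) α t ↔ X.step p α t :=
  ⟨fun h => by cases h; assumption, Tr.plain p α t⟩

theorem tr_bot {α : TimedAction Act} {t : TState X.P} :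
    X.Tr TState.bot α t ↔ α ∈ X.tA ∧ t = TState.bot := by
  constructor
  · intro h; cases h; exact ⟨by assumption, rfl⟩
  · rintro ⟨h, rfl⟩; exact Tr.bot α h

theorem Tr.eq_top {α : TimedAction Act} {t : TState X.P} (h : X.Tr TState.top α t) :
    t = TState.top := by
  cases h; rfl

theorem Admits.mem_tA {b : Bool} {w : List (TimedAction Act)} :
    ∀ {s : TState X.P}, X.Admits b s w → ∀ α ∈ w, α ∈ X.tA := by
  induction w with
  | nil => simp
  | cons β w ih =>
    rintro s ⟨t, h, ht⟩ α hα
    rcases List.mem_cons.1 hα with rfl | hα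
    · exact h.mem_tA
    · exact ih ht α hα

theorem not_admits_top {b : Bool} {w : List (TimedAction Act)} :
    ¬ X.Admits b TState.top w := by
  induction w with
  | nil => exact id
  | cons α w ih =>
    rintro ⟨t, h, ht⟩
    cases h.eq_top
    exact ih ht

theorem Admits.ne_top {b : Bool} {s : TState X.P} {w : List (TimedAction Act)}
    (h : X.Admits b s w) : s ≠ TState.top := by
  rintro rfl
  exact not_admits_top h

theorem Tr.ne_top {s t : TState X.P} {α : TimedAction Act} (h : X.Tr s α t)
    (ht : t ≠ TState.top) : s ≠ TState.top := by
  rintro rfl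
  exact ht h.eq_top

theorem admits_bot {b : Bool} {w : List (TimedAction Act)} (hw : ∀ α ∈ w, α ∈ X.tA) :
    X.Admits b TState.bot w := by
  induction w with
  | nil => exact True.intro
  | cons α w ih =>
    exact ⟨_, Tr.bot α (hw α (by simp)), ih fun β hβ => hw β (by simp [hβ])⟩

theorem final_true {s : TState X.P} (h : s ≠ TState.top) : Final true s := by
  cases s
  · exact h rfl
  · exact True.intro
  · rfl

end Words

/-- The restriction of a word to the timed alphabet of `X`; all delays are kept. -/
noncomputable def proj (X : TIOTS.{u, v} Act) (w : List (TimedAction Act)) :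
    List (TimedAction Act) :=
  open Classical in w.filter fun α => α ∈ X.tA

/-- `X` reads `α` if `α` is in its timed alphabet, and otherwise stays where it is. -/
def Move (X : TIOTS.{u, v} Act) (s : TState X.P) (α : TimedAction Act) (t : TState X.P) : Prop :=
  (α ∈ X.tA ∧ X.Tr s α t) ∨ (α ∉ X.tA ∧ t = s)

/-- `X.Allows b s w`: the completion of `X` admits the restriction of `w` to the alphabet
of `X`. -/
def Allows (X : TIOTS.{u, v} Act) (b : Bool) (s : TState X.P) (w : List (TimedAction Act)) : Prop :=
  X.completion.Admits b s (X.proj w)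

section Allows

variable {X : TIOTS.{u, v} Act}

theorem proj_eq_self {w : List (TimedAction Act)} (hw : ∀ α ∈ w, α ∈ X.tA) : X.proj w = w := by
  simpa [proj] using hw

theorem proj_congr {Y : TIOTS.{u, v} Act} (h : X.tA = Y.tA) (w : List (TimedAction Act)) :
    X.proj w = Y.proj w :=
  List.filter_congr fun α _ => by simp [h]

theorem mem_tA_of_mem_proj {α : TimedAction Act} {w : List (TimedAction Act)}
    (h : α ∈ X.proj w) : α ∈ X.tA := by
  simpa using (List.mem_filter.1 h).2

theorem allows_iff_admits {b : Bool} {s : TState X.P} {w : List (TimedAction Act)}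
    (hw : ∀ α ∈ w, α ∈ X.tA) : X.Allows b s w ↔ X.completion.Admits b s w := by
  rw [Allows, proj_eq_self hw]

theorem allows_nil {b : Bool} {s : TState X.P} : X.Allows b s [] ↔ Final b s := Iff.rfl

theorem allows_cons {b : Bool} {s : TState X.P} {α : TimedAction Act}
    {w : List (TimedAction Act)} :
    X.Allows b s (α :: w) ↔ ∃ t, X.completion.Move s α t ∧ X.Allows b t w := by
  by_cases h : α ∈ X.tA
  · have h1 : X.proj (α :: w) = α :: X.proj w := by simp [proj, h]
    rw [Allows, h1]
    constructor
    · rintro ⟨t, ht, hw⟩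
      exact ⟨t, Or.inl ⟨h, ht⟩, hw⟩
    · rintro ⟨t, ⟨-, ht⟩ | ⟨h', -⟩, hw⟩
      · exact ⟨t, ht, hw⟩
      · exact absurd h h'
  · have h1 : X.proj (α :: w) = X.proj w := by simp [proj, h]
    rw [Allows, h1]
    constructor
    · intro hw
      exact ⟨s, Or.inr ⟨h, rfl⟩, hw⟩
    · rintro ⟨t, ⟨h', -⟩ | ⟨-, rfl⟩, hw⟩
      · exact absurd h' h
      · exact hw

theorem not_allows_top {b : Bool} {w : List (TimedAction Act)} : ¬ X.Allows b TState.top w :=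
  not_admits_top (X := X.completion)

theorem allows_bot {b : Bool} {w : List (TimedAction Act)} : X.Allows b TState.bot w :=
  admits_bot (X := X.completion) fun _ hα => mem_tA_of_mem_proj hα

/-- At plain states the completion enables the whole timed alphabet. -/
theorem completion_total (p : X.P) {α : TimedAction Act} (hα : α ∈ X.tA) :
    ∃ s, X.completion.step p α s := by
  by_cases h : X.botCompletion.Enabled p α
  · obtain ⟨s, hs⟩ := h
    exact ⟨s, Or.inl hs⟩
  · refine ⟨TState.top, Or.inr ⟨rfl, ?_, h⟩⟩
    rintro a rfl
    refine (hα a rfl).resolve_left fun ha => h ?_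
    by_cases h' : X.Enabled p (TimedAction.act a)
    · obtain ⟨s, hs⟩ := h'
      exact ⟨s, Or.inl hs⟩
    · exact ⟨TState.bot, Or.inr ⟨rfl, ⟨a, ha, rfl⟩, h'⟩⟩

theorem completion_step_of_total {p : X.P} (hp : ∀ α ∈ X.tA, X.Enabled p α)
    {α : TimedAction Act} {s : TState X.P} : X.completion.step p α s ↔ X.step p α s := by
  constructor
  · rintro ((h | ⟨-, ⟨a, ha, rfl⟩, h⟩) | ⟨-, hα, h⟩)
    · exact h
    · refine absurd (hp _ ?_) h
      rintro b ⟨⟩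
      exact Or.inl ha
    · obtain ⟨t, ht⟩ := hp α fun a ha => Or.inr (hα a ha)
      exact absurd ⟨t, Or.inl ht⟩ h
  · exact fun h => Or.inl (Or.inl h)

theorem exists_move (p : X.P) (α : TimedAction Act) :
    ∃ t, X.completion.Move (TState.plain p) α t := by
  by_cases h : α ∈ X.tA
  · obtain ⟨s, hs⟩ := completion_total p h
    exact ⟨s, Or.inl ⟨h, Tr.plain _ _ _ hs⟩⟩
  · exact ⟨_, Or.inr ⟨h, rfl⟩⟩

end Allows

/-! ### Transitions of the completed compositions -/

section Comp

variable {op : Op} {X Y : TIOTS.{u, v} Act} {h : Composable op X Y}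

theorem mem_or_of_mem_comp_tA {α : TimedAction Act} (hα : α ∈ (comp op X Y h).tA) :
    α ∈ X.tA ∨ α ∈ Y.tA := by
  cases α with
  | delay d => exact Or.inl fun a ha => by cases ha
  | act a =>
    have h1 : a ∈ compI op X Y ∪ compO op X Y := hα a rfl
    have h2 : a ∈ X.A ∨ a ∈ Y.A := by
      cases op <;> simp only [A, compI, compO, Set.mem_union, Set.mem_sdiff] at * <;> tauto
    refine h2.imp (fun h2 => ?_) fun h2 => ?_ <;> rintro b ⟨⟩ <;> exact h2

theorem compStep_pair {p : X.P} {q : Y.P} {α : TimedAction Act}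
    {t : TState (CompState X.P Y.P)} (hα : α ∈ X.tA ∨ α ∈ Y.tA) :
    CompStep op X.completion Y.completion (CompState.pair p q) α t ↔
      ∃ t₀ t₁, X.completion.Move (TState.plain p) α t₀ ∧
        Y.completion.Move (TState.plain q) α t₁ ∧ t = combine op t₀ t₁ := by
  constructor
  · intro h
    cases h with
    | sync h0 h1 =>
      have h0 := Tr.plain _ _ _ h0
      have h1 := Tr.plain _ _ _ h1
      exact ⟨_, _, Or.inl ⟨h0.mem_tA, h0⟩, Or.inl ⟨h1.mem_tA, h1⟩, rfl⟩
    | actLeft h0 h1 =>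
      have h0 := Tr.plain _ _ _ h0
      exact ⟨_, _, Or.inl ⟨h0.mem_tA, h0⟩, Or.inr ⟨fun h => h1 (h _ rfl), rfl⟩, rfl⟩
    | actRight h1 h0 =>
      have h1 := Tr.plain _ _ _ h1
      exact ⟨_, _, Or.inr ⟨fun h => h0 (h _ rfl), rfl⟩, Or.inl ⟨h1.mem_tA, h1⟩, rfl⟩
  · rintro ⟨t₀, t₁, ⟨h0, h0'⟩ | ⟨h0, rfl⟩, ⟨h1, h1'⟩ | ⟨h1, rfl⟩, rfl⟩
    · exact CompStep.sync (tr_plain.1 h0') (tr_plain.1 h1')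
    · cases α with
      | delay d => exact absurd (fun a ha => by cases ha) h1
      | act a =>
        refine CompStep.actLeft (tr_plain.1 h0') fun ha => h1 ?_
        rintro b ⟨⟩
        exact ha
    · cases α with
      | delay d => exact absurd (fun a ha => by cases ha) h0
      | act a =>
        refine CompStep.actRight (tr_plain.1 h1') fun ha => h0 ?_
        rintro b ⟨⟩
        exact ha
    · exact absurd hα (by rintro (h | h); exacts [h0 h, h1 h])

theorem comp_enabled_pair (p : X.P) (q : Y.P) {α : TimedAction Act}
    (hα : α ∈ (comp op X Y h).tA) : (comp op X Y h).Enabled (CompState.pair p q) α := by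
  obtain ⟨s, hs⟩ := exists_move p α
  obtain ⟨t, ht⟩ := exists_move q α
  exact ⟨_, (compStep_pair (mem_or_of_mem_comp_tA hα)).2 ⟨s, t, hs, ht, rfl⟩⟩

/-- At pairs of plain states the completion of a composition adds no transitions, because the
operands have been completed already. -/
theorem comp_tr_pair {p : X.P} {q : Y.P} {α : TimedAction Act}
    {t : TState (CompState X.P Y.P)} (hα : α ∈ (comp op X Y h).tA) :
    (comp op X Y h).completion.Tr (TState.plain (CompState.pair p q)) α t ↔
      ∃ t₀ t₁, X.completion.Move (TState.plain p) α t₀ ∧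
        Y.completion.Move (TState.plain q) α t₁ ∧ t = combine op t₀ t₁ := by
  refine (tr_plain (X := (comp op X Y h).completion)).trans ?_
  refine (completion_step_of_total fun β hβ => comp_enabled_pair p q hβ).trans ?_
  exact compStep_pair (mem_or_of_mem_comp_tA hα)

theorem admits_pair_cons {b : Bool} {p : X.P} {q : Y.P} {α : TimedAction Act}
    {w : List (TimedAction Act)} (hα : α ∈ (comp op X Y h).tA)
    {R : TState X.P → TState Y.P → Prop}
    (hR : ∀ t₀ t₁, (comp op X Y h).completion.Admits b (combine op t₀ t₁) w ↔ R t₀ t₁) :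
    (comp op X Y h).completion.Admits b (TState.plain (CompState.pair p q)) (α :: w) ↔
      ∃ t₀ t₁, X.completion.Move (TState.plain p) α t₀ ∧
        Y.completion.Move (TState.plain q) α t₁ ∧ R t₀ t₁ := by
  constructor
  · rintro ⟨t, ht, hw⟩
    obtain ⟨t₀, t₁, h0, h1, rfl⟩ := (comp_tr_pair hα).1 ht
    exact ⟨t₀, t₁, h0, h1, (hR _ _).1 hw⟩
  · rintro ⟨t₀, t₁, h0, h1, hw⟩
    exact ⟨_, (comp_tr_pair hα).2 ⟨t₀, t₁, h0, h1, rfl⟩, (hR _ _).2 hw⟩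

end Comp

/-! ### Conjunction and disjunction -/

section Lattice

variable {op : Op} {X Y : TIOTS.{u, v} Act} {h : Composable op X Y}

/-- At the states of its left operand alone, a composition behaves as the left operand. -/
theorem admits_inLeft (hA : (comp op X Y h).tA = X.tA) {b : Bool} {w : List (TimedAction Act)}
    (hw : ∀ α ∈ w, α ∈ (comp op X Y h).tA) :
    ∀ s : TState X.P, (comp op X Y h).completion.Admits b (inLeft s) w ↔ X.Allows b s w := by
  have key : ∀ s : TState X.P,
      (comp op X Y h).completion.Admits b (inLeft s) w ↔ X.completion.Admits b s w := by
    induction w with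
    | nil => intro s; cases s <;> exact Iff.rfl
    | cons α w ih =>
      intro s
      have hw' : ∀ β ∈ w, β ∈ (comp op X Y h).tA := fun β hβ => hw β (by simp [hβ])
      cases s with
      | top => exact iff_of_false not_admits_top not_admits_top
      | bot =>
        refine iff_of_true (admits_bot (X := (comp op X Y h).completion) hw)
          (admits_bot (X := X.completion) ?_)
        rwa [hA] at hw
      | plain p =>
        have tot : ∀ β ∈ (comp op X Y h).tA, (comp op X Y h).Enabled (CompState.left p) β := by
          intro β hβ
          rw [hA] at hβ
          obtain ⟨t, ht⟩ := completion_total p hβ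
          exact ⟨_, CompStep.left ht⟩
        constructor
        · rintro ⟨t, ht, hw⟩
          have h1 := (completion_step_of_total tot).1 (tr_plain.1 ht)
          cases h1 with
          | left h0 => exact ⟨_, Tr.plain _ _ _ h0, (ih hw' _).1 hw⟩
        · rintro ⟨t, ht, hw⟩
          exact ⟨inLeft t, Tr.plain _ _ _ ((completion_step_of_total tot).2
            (CompStep.left (tr_plain.1 ht))), (ih hw' _).2 hw⟩
  intro s
  rw [key, allows_iff_admits]
  rwa [hA] at hw

/-- At the states of its right operand alone, a composition behaves as the right operand. -/
theorem admits_inRight (hA : (comp op X Y h).tA = Y.tA) {b : Bool} {w : List (TimedAction Act)}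
    (hw : ∀ α ∈ w, α ∈ (comp op X Y h).tA) :
    ∀ s : TState Y.P, (comp op X Y h).completion.Admits b (inRight s) w ↔ Y.Allows b s w := by
  have key : ∀ s : TState Y.P,
      (comp op X Y h).completion.Admits b (inRight s) w ↔ Y.completion.Admits b s w := by
    induction w with
    | nil => intro s; cases s <;> exact Iff.rfl
    | cons α w ih =>
      intro s
      have hw' : ∀ β ∈ w, β ∈ (comp op X Y h).tA := fun β hβ => hw β (by simp [hβ])
      cases s with
      | top => exact iff_of_false not_admits_top not_admits_top
      | bot =>
        refine iff_of_true (admits_bot (X := (comp op X Y h).completion) hw)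
          (admits_bot (X := Y.completion) ?_)
        rwa [hA] at hw
      | plain p =>
        have tot : ∀ β ∈ (comp op X Y h).tA, (comp op X Y h).Enabled (CompState.right p) β := by
          intro β hβ
          rw [hA] at hβ
          obtain ⟨t, ht⟩ := completion_total p hβ
          exact ⟨_, CompStep.right ht⟩
        constructor
        · rintro ⟨t, ht, hw⟩
          have h1 := (completion_step_of_total tot).1 (tr_plain.1 ht)
          cases h1 with
          | right h0 => exact ⟨_, Tr.plain _ _ _ h0, (ih hw' _).1 hw⟩
        · rintro ⟨t, ht, hw⟩
          exact ⟨inRight t, Tr.plain _ _ _ ((completion_step_of_total tot).2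
            (CompStep.right (tr_plain.1 ht))), (ih hw' _).2 hw⟩
  intro s
  rw [key, allows_iff_admits]
  rwa [hA] at hw

theorem tA_congr (hI : X.I = Y.I) (hO : X.O = Y.O) : X.tA = Y.tA := by
  simp only [tA, A, hI, hO]

/-- A conjunction leads to `⊥` (to a state other than `⊤`) exactly if both operands do: the
operand that reaches `⊥` first leaves the other one to decide. -/
theorem admits_conj {h : Composable Op.conj X Y} {b : Bool} {w : List (TimedAction Act)}
    (hw : ∀ α ∈ w, α ∈ (comp Op.conj X Y h).tA) :
    ∀ (s₀ : TState X.P) (s₁ : TState Y.P),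
      (comp Op.conj X Y h).completion.Admits b (combine Op.conj s₀ s₁) w ↔
        X.Allows b s₀ w ∧ Y.Allows b s₁ w := by
  have hX : (comp Op.conj X Y h).tA = X.tA := tA_congr rfl rfl
  have hY : (comp Op.conj X Y h).tA = Y.tA := tA_congr h.1 h.2
  induction w with
  | nil =>
    intro s₀ s₁
    cases s₀ <;> cases s₁ <;> simp [combine, allows_nil, Admits, Final, inLeft, inRight]
  | cons α w ih =>
    intro s₀ s₁
    have ih := ih fun β hβ => hw β (by simp [hβ])
    cases s₀ with
    | top => exact iff_of_false not_admits_top fun h => not_allows_top h.1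
    | bot =>
      cases s₁ with
      | top => exact iff_of_false not_admits_top fun h => not_allows_top h.2
      | bot => exact (admits_inRight hY hw TState.bot).trans (and_iff_right allows_bot).symm
      | plain q =>
        exact (admits_inRight hY hw (TState.plain q)).trans (and_iff_right allows_bot).symm
    | plain p =>
      cases s₁ with
      | top => exact iff_of_false not_admits_top fun h => not_allows_top h.2
      | bot => exact (admits_inLeft hX hw (TState.plain p)).trans (and_iff_left allows_bot).symm
      | plain q =>
        refine (admits_pair_cons (hw α (by simp)) ih).trans ?_
        simp only [allows_cons]
        constructor
        · rintro ⟨t₀, t₁, h0, h1, h2, h3⟩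
          exact ⟨⟨t₀, h0, h2⟩, t₁, h1, h3⟩
        · rintro ⟨⟨t₀, h0, h2⟩, t₁, h1, h3⟩
          exact ⟨t₀, t₁, h0, h1, h2, h3⟩

/-- A disjunction leads to `⊥` (to a state other than `⊤`) exactly if one of its operands does.
Every completed operand can read every word until it reaches `⊥` or `⊤`, so that the run of one
operand is never blocked by the other. -/
theorem admits_disj {h : Composable Op.disj X Y} {b : Bool} {w : List (TimedAction Act)}
    (hw : ∀ α ∈ w, α ∈ (comp Op.disj X Y h).tA) :
    ∀ (s₀ : TState X.P) (s₁ : TState Y.P),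
      (comp Op.disj X Y h).completion.Admits b (combine Op.disj s₀ s₁) w ↔
        X.Allows b s₀ w ∨ Y.Allows b s₁ w := by
  have hX : (comp Op.disj X Y h).tA = X.tA := tA_congr rfl rfl
  have hY : (comp Op.disj X Y h).tA = Y.tA := tA_congr h.1 h.2
  induction w with
  | nil =>
    intro s₀ s₁
    cases s₀ <;> cases s₁ <;> simp [combine, allows_nil, Admits, Final, inLeft, inRight]
  | cons α w ih =>
    intro s₀ s₁
    have ih := ih fun β hβ => hw β (by simp [hβ])
    have hbot := admits_bot (X := (comp Op.disj X Y h).completion) (b := b) hw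
    cases s₀ with
    | bot => exact iff_of_true hbot (Or.inl allows_bot)
    | top =>
      cases s₁ with
      | bot => exact iff_of_true hbot (Or.inr allows_bot)
      | top => exact (admits_inRight hY hw TState.top).trans (or_iff_right not_allows_top).symm
      | plain q =>
        exact (admits_inRight hY hw (TState.plain q)).trans (or_iff_right not_allows_top).symm
    | plain p =>
      cases s₁ with
      | bot => exact iff_of_true hbot (Or.inr allows_bot)
      | top =>
        exact (admits_inLeft hX hw (TState.plain p)).trans (or_iff_left not_allows_top).symm
      | plain q =>
        refine (admits_pair_cons (hw α (by simp)) ih).trans ?_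
        simp only [allows_cons]
        constructor
        · rintro ⟨t₀, t₁, h0, h1, h2 | h3⟩
          · exact Or.inl ⟨t₀, h0, h2⟩
          · exact Or.inr ⟨t₁, h1, h3⟩
        · rintro (⟨t₀, h0, h2⟩ | ⟨t₁, h1, h3⟩)
          -- The run of one operand determines the result, but the other one has to move along.
          · obtain ⟨t₁, h1⟩ := exists_move q α
            exact ⟨t₀, t₁, h0, h1, Or.inl h2⟩
          · obtain ⟨t₀, h0⟩ := exists_move p α
            exact ⟨t₀, t₁, h0, h1, Or.inr h3⟩

end Lattice

/-! ### Parallel composition -/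

section Par

variable {X Y : TIOTS.{u, v} Act}

/-- A parallel composition reaches `⊥` as soon as one operand does so while the other one has not
reached `⊤`; otherwise it survives as long as both operands do. -/
theorem admits_par {h : Composable Op.par X Y} {b : Bool} {w : List (TimedAction Act)}
    (hw : ∀ α ∈ w, α ∈ (comp Op.par X Y h).tA) :
    ∀ (s₀ : TState X.P) (s₁ : TState Y.P),
      (comp Op.par X Y h).completion.Admits b (combine Op.par s₀ s₁) w ↔
        (∃ u, u <+: w ∧ (X.Allows false s₀ u ∧ Y.Allows true s₁ u ∨
          X.Allows true s₀ u ∧ Y.Allows false s₁ u)) ∨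
        (b = true ∧ X.Allows true s₀ w ∧ Y.Allows true s₁ w) := by
  induction w with
  | nil =>
    intro s₀ s₁
    cases s₀ <;> cases s₁ <;> simp [combine, allows_nil, Admits, Final]
  | cons α w ih =>
    intro s₀ s₁
    have ih := ih fun β hβ => hw β (by simp [hβ])
    have hbot := admits_bot (X := (comp Op.par X Y h).completion) (b := b) hw
    cases s₀ with
    | top =>
      refine iff_of_false not_admits_top ?_
      simp [not_allows_top]
    | bot =>
      cases s₁ with
      | top =>
        refine iff_of_false not_admits_top ?_
        simp [not_allows_top]
      | bot => exact iff_of_true hbot (Or.inl ⟨[], by simp, Or.inl ⟨True.intro, True.intro⟩⟩)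
      | plain q => exact iff_of_true hbot (Or.inl ⟨[], by simp, Or.inl ⟨True.intro, rfl⟩⟩)
    | plain p =>
      cases s₁ with
      | top =>
        refine iff_of_false not_admits_top ?_
        simp [not_allows_top]
      | bot => exact iff_of_true hbot (Or.inl ⟨[], by simp, Or.inr ⟨rfl, True.intro⟩⟩)
      | plain q =>
        refine (admits_pair_cons (hw α (by simp)) ih).trans ?_
        constructor
        · rintro ⟨t₀, t₁, h0, h1, ⟨u, hu, h2⟩ | ⟨rfl, h2, h3⟩⟩
          · refine Or.inl ⟨α :: u, by simpa using hu, ?_⟩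
            simp only [allows_cons]
            exact h2.imp (fun h2 => ⟨⟨t₀, h0, h2.1⟩, t₁, h1, h2.2⟩)
              fun h2 => ⟨⟨t₀, h0, h2.1⟩, t₁, h1, h2.2⟩
          · exact Or.inr ⟨rfl, allows_cons.2 ⟨t₀, h0, h2⟩, allows_cons.2 ⟨t₁, h1, h3⟩⟩
        · rintro (⟨u, hu, h2⟩ | ⟨rfl, h2, h3⟩)
          · rcases List.prefix_cons_iff.1 hu with rfl | ⟨u, rfl, hu'⟩
            · simp [allows_nil, Final] at h2
            · simp only [allows_cons] at h2
              rcases h2 with ⟨⟨t₀, h0, h2⟩, t₁, h1, h3⟩ | ⟨⟨t₀, h0, h2⟩, t₁, h1, h3⟩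
              · exact ⟨t₀, t₁, h0, h1, Or.inl ⟨u, hu', Or.inl ⟨h2, h3⟩⟩⟩
              · exact ⟨t₀, t₁, h0, h1, Or.inl ⟨u, hu', Or.inr ⟨h2, h3⟩⟩⟩
          · obtain ⟨t₀, h0, h2⟩ := allows_cons.1 h2
            obtain ⟨t₁, h1, h3⟩ := allows_cons.1 h3
            exact ⟨t₀, t₁, h0, h1, Or.inr ⟨rfl, h2, h3⟩⟩

end Par

/-! ### Quotient -/

section Quot

variable {X Y : TIOTS.{u, v} Act}

theorem Deterministic.completion (hY : Y.Deterministic) : Y.completion.Deterministic := by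
  intro s α s' s'' h1 h2
  cases s with
  | top => rw [h1.eq_top, h2.eq_top]
  | bot => rw [(tr_bot.1 h1).2, (tr_bot.1 h2).2]
  | plain p =>
    have h1 := tr_plain.1 h1
    have h2 := tr_plain.1 h2
    rcases h1 with (h1 | ⟨rfl, h3, h1⟩) | ⟨rfl, h3, h1⟩ <;>
      rcases h2 with (h2 | ⟨rfl, h4, h2⟩) | ⟨rfl, h4, h2⟩
    · exact hY _ _ _ _ (Tr.plain _ _ _ h1) (Tr.plain _ _ _ h2)
    · exact absurd ⟨_, h1⟩ h2
    · exact absurd ⟨_, Or.inl h1⟩ h2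
    · exact absurd ⟨_, h2⟩ h1
    · rfl
    · exact absurd ⟨_, Or.inr ⟨rfl, h3, h1⟩⟩ h2
    · exact absurd ⟨_, Or.inl h2⟩ h1
    · exact absurd ⟨_, Or.inr ⟨rfl, h4, h2⟩⟩ h1
    · rfl

theorem Deterministic.move_unique (hY : Y.Deterministic) {s t t' : TState Y.P}
    {α : TimedAction Act} (h : Y.completion.Move s α t) (h' : Y.completion.Move s α t') :
    t = t' := by
  rcases h with ⟨hα, h⟩ | ⟨hα, rfl⟩ <;> rcases h' with ⟨hα', h'⟩ | ⟨hα', rfl⟩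
  · exact hY.completion _ _ _ _ h h'
  · exact absurd hα hα'
  · exact absurd hα' hα
  · rfl

theorem Deterministic.allows_cons (hY : Y.Deterministic) {b : Bool} {s t : TState Y.P}
    {α : TimedAction Act} {w : List (TimedAction Act)} (h : Y.completion.Move s α t) :
    Y.Allows b s (α :: w) ↔ Y.Allows b t w := by
  rw [TIOTS.allows_cons]
  constructor
  · rintro ⟨t', h', hw⟩
    rwa [hY.move_unique h h']
  · exact fun hw => ⟨t, h, hw⟩

/-- A quotient reaches `⊥` at a word `u` if, up to the letter before, the right operand has reached
neither `⊥` nor `⊤`, and at `u` the left operand reaches `⊥`, or the right operand reaches `⊤` while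
the left one had not done so the letter before. Otherwise the quotient survives as long as the left
operand has not reached `⊤` and the right one is in a plain state. Since the right operand is
deterministic, the words that lead it to `⊤` are those that it does not admit. -/
theorem admits_quot {h : Composable Op.quot X Y} {b : Bool} {w : List (TimedAction Act)}
    (hw : ∀ α ∈ w, α ∈ (comp Op.quot X Y h).tA) :
    ∀ (s₀ : TState X.P) (s₁ : TState Y.P),
      (comp Op.quot X Y h).completion.Admits b (combine Op.quot s₀ s₁) w ↔
        (∃ u, u <+: w ∧
          (u = [] ∨ Y.Allows true s₁ u.dropLast ∧ ¬ Y.Allows false s₁ u.dropLast) ∧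
          (X.Allows false s₀ u ∨
            ¬ Y.Allows true s₁ u ∧ (u = [] ∨ X.Allows true s₀ u.dropLast))) ∨
        (b = true ∧ X.Allows true s₀ w ∧ Y.Allows true s₁ w ∧ ¬ Y.Allows false s₁ w) := by
  have hY : Y.Deterministic := h.2.2
  -- `⊤ % s = ⊤` for `s ≠ ⊤`: from such a state nothing is admitted on the right-hand side.
  have htop : ∀ {q : TState Y.P} {w : List (TimedAction Act)}, q ≠ TState.top →
      ¬ ((∃ u, u <+: w ∧
          (u = [] ∨ Y.Allows true q u.dropLast ∧ ¬ Y.Allows false q u.dropLast) ∧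
          (X.Allows false TState.top u ∨
            ¬ Y.Allows true q u ∧ (u = [] ∨ X.Allows true TState.top u.dropLast))) ∨
        (b = true ∧ X.Allows true TState.top w ∧ Y.Allows true q w ∧ ¬ Y.Allows false q w)) := by
    rintro q w hq (⟨u, -, -, hu | ⟨hu, rfl | hu'⟩⟩ | ⟨-, hu, -⟩)
    · exact not_allows_top hu
    · exact hu (final_true hq)
    · exact not_allows_top hu'
    · exact not_allows_top hu
  induction w with
  | nil =>
    intro s₀ s₁
    cases s₀ <;> cases s₁ <;> simp [combine, allows_nil, Admits, Final]
  | cons α w ih =>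
    intro s₀ s₁
    have ih := ih fun β hβ => hw β (by simp [hβ])
    have hbot := admits_bot (X := (comp Op.quot X Y h).completion) (b := b) hw
    cases s₁ with
    | top =>
      refine iff_of_true ?_ (Or.inl ⟨[], by simp, Or.inl rfl, Or.inr ⟨id, Or.inl rfl⟩⟩)
      cases s₀ <;> exact hbot
    | bot =>
      cases s₀ with
      | top => exact iff_of_false not_admits_top (htop (by simp))
      | bot =>
        exact iff_of_true hbot (Or.inl ⟨[], by simp, Or.inl rfl, Or.inl True.intro⟩)
      | plain p =>
        refine iff_of_false not_admits_top ?_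
        rintro (⟨u, -, rfl | hu, hu'⟩ | ⟨-, -, -, hu⟩)
        · simp [allows_nil, Final] at hu'
        · exact hu.2 allows_bot
        · exact hu allows_bot
    | plain q =>
      cases s₀ with
      | top => exact iff_of_false not_admits_top (htop (by simp))
      | bot =>
        exact iff_of_true hbot (Or.inl ⟨[], by simp, Or.inl rfl, Or.inl True.intro⟩)
      | plain p =>
        refine (admits_pair_cons (hw α (by simp)) ih).trans ?_
        obtain ⟨t₁, h1⟩ := exists_move q α
        have hq : ∀ c v, Y.Allows c (TState.plain q) (α :: v) ↔ Y.Allows c t₁ v :=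
          fun _ _ => hY.allows_cons h1
        constructor
        · rintro ⟨t₀, t₁', h0, h1', h2⟩
          obtain rfl := hY.move_unique h1 h1'
          rcases h2 with ⟨u, hu, h2, h3⟩ | ⟨rfl, h2, h3⟩
          · refine Or.inl ⟨α :: u, by simpa using hu, Or.inr ?_, ?_⟩
            · rcases eq_or_ne u [] with rfl | hne
              · exact ⟨rfl, Bool.false_ne_true⟩
              · rw [List.dropLast_cons_of_ne_nil hne, hq, hq]
                exact h2.resolve_left hne
            · refine h3.imp (fun h3 => allows_cons.2 ⟨t₀, h0, h3⟩) fun h3 => ?_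
              refine ⟨by rw [hq]; exact h3.1, Or.inr ?_⟩
              rcases eq_or_ne u [] with rfl | hne
              · exact rfl
              · rw [List.dropLast_cons_of_ne_nil hne]
                exact allows_cons.2 ⟨t₀, h0, h3.2.resolve_left hne⟩
          · exact Or.inr ⟨rfl, allows_cons.2 ⟨t₀, h0, h2⟩, by rwa [hq, hq]⟩
        · rintro (⟨u, hu, h2, h3⟩ | ⟨rfl, h2, h3⟩)
          · rcases List.prefix_cons_iff.1 hu with rfl | ⟨u, rfl, hu'⟩
            · simp [allows_nil, Final] at h3
            · have h2 := h2.resolve_left (by simp)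
              rcases eq_or_ne u [] with rfl | hne
              · rcases h3 with h3 | ⟨h3, -⟩
                · obtain ⟨t₀, h0, h3⟩ := allows_cons.1 h3
                  exact ⟨t₀, t₁, h0, h1, Or.inl ⟨[], hu', Or.inl rfl, Or.inl h3⟩⟩
                · obtain ⟨t₀, h0⟩ := exists_move p α
                  rw [hq] at h3
                  exact ⟨t₀, t₁, h0, h1, Or.inl ⟨[], hu', Or.inl rfl, Or.inr ⟨h3, Or.inl rfl⟩⟩⟩
              · rw [List.dropLast_cons_of_ne_nil hne, hq, hq] at h2
                rw [List.dropLast_cons_of_ne_nil hne] at h3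
                rcases h3 with h3 | ⟨h3, h4⟩
                · obtain ⟨t₀, h0, h3⟩ := allows_cons.1 h3
                  exact ⟨t₀, t₁, h0, h1, Or.inl ⟨u, hu', Or.inr h2, Or.inl h3⟩⟩
                · obtain ⟨t₀, h0, h4⟩ := allows_cons.1 (h4.resolve_left (by simp))
                  rw [hq] at h3
                  exact ⟨t₀, t₁, h0, h1, Or.inl ⟨u, hu', Or.inr h2, Or.inr ⟨h3, Or.inr h4⟩⟩⟩
          · obtain ⟨t₀, h0, h2⟩ := allows_cons.1 h2
            exact ⟨t₀, t₁, h0, h1, Or.inr ⟨rfl, h2, by rwa [hq, hq] at h3⟩⟩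

end Quot

/-! ### Test environments -/

section Test

/-- A timed action over `B` as a timed action over `Act`. -/
def decode {B : Type u} (f : B → Act) : TimedAction B → TimedAction Act
  | TimedAction.act c => TimedAction.act (f c)
  | TimedAction.delay d => TimedAction.delay d

/-- The state of a test that still has to perform the word `v`; the test that has nothing left to
perform is in `⊥` if `b = true`. -/
def testState {B : Type u} (b : Bool) : List (TimedAction B) → TState (List (TimedAction B))
  | [] => if b then TState.bot else TState.plain []
  | α :: v => TState.plain (α :: v)

/-- The delays of a test with remaining word `v`: a delay can stop within a delay of the word,
it can match it, and it can extend over several of them. At the end of the word, a delay leads to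
`⊥` if `b = true`. -/
def testDelay {B : Type u} (b : Bool) :
    List (TimedAction B) → {d : ℝ // 0 < d} → TState (List (TimedAction B)) → Prop
  | [], _, s => b = true ∧ s = TState.bot
  | TimedAction.act _ :: _, _, _ => False
  | TimedAction.delay d :: v, e, s =>
    (∃ d', e + d' = d ∧ s = TState.plain (TimedAction.delay d' :: v)) ∨
      (e = d ∧ s = testState b v) ∨ ∃ e', d + e' = e ∧ testDelay b v e' s

/-- The environment of `X` that performs the word `w` and, if `b = true`, then fails. All its inputs
may lead to `⊤`, which stops the run. Its states are the words that remain to be performed, over a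
type `B` of codes for actions, because `List (TimedAction Act)` need not lie in the universe of the
states. -/
def testEnv (X : TIOTS.{u, v} Act) {B : Type u} (f : B → Act) (hf : ∀ c, f c ∈ X.A) (b : Bool)
    (w : List (TimedAction B)) : TIOTS.{u, v} Act where
  I := X.O
  O := X.I
  disj := X.disj.symm
  P := List (TimedAction B)
  init := testState b w
  step v α s :=
    (∃ e, α = TimedAction.delay e ∧ testDelay b v e s) ∨
      (∃ a ∈ X.O, α = TimedAction.act a ∧ s = TState.top) ∨
        ∃ c v', v = TimedAction.act c :: v' ∧ α = TimedAction.act (f c) ∧ s = testState b v'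
  mem_of_step := by
    rintro p a s (⟨e, h, -⟩ | ⟨_, h, ⟨⟩, -⟩ | ⟨c, v', -, ⟨⟩, -⟩)
    · cases h
    · exact Or.inl h
    · exact (hf c).symm

/-- What a test in state `s` still has to perform. -/
def remaining {B : Type u} : TState (List (TimedAction B)) → List (TimedAction B)
  | TState.plain v => v
  | _ => []

variable {X : TIOTS.{u, v} Act} {B : Type u} {f : B → Act} {hf : ∀ c, f c ∈ X.A} {b : Bool}
  {w : List (TimedAction B)}

theorem remaining_testState (v : List (TimedAction B)) : remaining (testState b v) = v := by
  cases v <;> cases b <;> rfl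

theorem testEnv_tr_delay {v : List (TimedAction B)} {e : {d : ℝ // 0 < d}}
    {s : TState (List (TimedAction B))} :
    (testEnv X f hf b w).Tr (TState.plain v) (TimedAction.delay e) s ↔ testDelay b v e s := by
  refine (tr_plain (X := testEnv X f hf b w)).trans ⟨?_, ?_⟩
  · rintro (⟨e, ⟨⟩, h⟩ | ⟨a, -, h, -⟩ | ⟨c, v', -, h, -⟩)
    · exact h
    · cases h
    · cases h
  · exact fun h => Or.inl ⟨e, rfl, h⟩

theorem delay_mem_tA (Y : TIOTS.{u, v} Act) (d : {d : ℝ // 0 < d}) :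
    TimedAction.delay d ∈ Y.tA := by
  intro a ha
  cases ha

theorem testEnv_tr_testState {v : List (TimedAction B)} {e : {d : ℝ // 0 < d}}
    {s : TState (List (TimedAction B))} :
    (testEnv X f hf b w).Tr (testState b v) (TimedAction.delay e) s ↔ testDelay b v e s := by
  cases v with
  | cons α v => exact testEnv_tr_delay
  | nil =>
    cases b with
    | false => exact testEnv_tr_delay
    | true =>
      refine (tr_bot (X := testEnv X f hf true w)).trans ?_
      exact and_congr_left' (iff_of_true (delay_mem_tA _ _) rfl)

theorem exists_add_of_lt {d e : {d : ℝ // 0 < d}} (h : d < e) : ∃ r, d + r = e :=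
  ⟨⟨e.1 - d.1, sub_pos.2 h⟩, Subtype.ext (add_sub_cancel d.1 e.1)⟩

theorem pos_add_left_cancel {d r s : {d : ℝ // 0 < d}} (h : d + r = d + s) : r = s :=
  Subtype.ext (add_left_cancel (congrArg Subtype.val h))

theorem testEnv_timeAdditive : (testEnv X f hf b w).TimeAdditive := by
  intro v d₁ d₂ s'
  have ht : ∀ {v e s}, (testEnv X f hf b w).Tr (testState b v) (TimedAction.delay e) s ↔
    testDelay b v e s := testEnv_tr_testState
  have hp : ∀ {v e s}, (testEnv X f hf b w).Tr (TState.plain v) (TimedAction.delay e) s ↔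
    testDelay b v e s := testEnv_tr_delay
  refine hp.trans (Iff.trans ?_ (exists_congr fun s => and_congr_left' hp).symm)
  change List (TimedAction B) at v
  induction v generalizing d₁ d₂ s' with
  | nil =>
    constructor
    · rintro ⟨hb, rfl⟩
      exact ⟨TState.bot, ⟨hb, rfl⟩, tr_bot.2 ⟨delay_mem_tA _ _, rfl⟩⟩
    · rintro ⟨s, ⟨hb, rfl⟩, h⟩
      exact ⟨hb, (tr_bot.1 h).2⟩
  | cons α v ih =>
    cases α with
    | act c => exact iff_of_false id fun ⟨s, h, _⟩ => h
    | delay d =>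
      constructor
      · rintro (⟨d', rfl, rfl⟩ | ⟨rfl, rfl⟩ | ⟨e', he, h⟩)
        · exact ⟨TState.plain (TimedAction.delay (d₂ + d') :: v),
            Or.inl ⟨_, (add_assoc _ _ _).symm, rfl⟩, hp.2 (Or.inl ⟨_, rfl, rfl⟩)⟩
        · exact ⟨TState.plain (TimedAction.delay d₂ :: v), Or.inl ⟨_, rfl, rfl⟩,
            hp.2 (Or.inr (Or.inl ⟨rfl, rfl⟩))⟩
        -- The intermediate state depends on whether `d₁` ends within, at the end of, or after
        -- the first delay of the word.
        · rcases lt_trichotomy d₁ d with hd | rfl | hd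
          · obtain ⟨r, rfl⟩ := exists_add_of_lt hd
            refine ⟨TState.plain (TimedAction.delay r :: v), Or.inl ⟨_, rfl, rfl⟩,
              hp.2 (Or.inr (Or.inr ⟨e', ?_, h⟩))⟩
            rw [add_assoc] at he
            exact pos_add_left_cancel he
          · obtain rfl := pos_add_left_cancel he
            exact ⟨testState b v, Or.inr (Or.inl ⟨rfl, rfl⟩), ht.2 h⟩
          · obtain ⟨r, rfl⟩ := exists_add_of_lt hd
            rw [add_assoc] at he
            obtain rfl := pos_add_left_cancel he
            obtain ⟨s, h1, h2⟩ := (ih _ _ _).1 h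
            exact ⟨s, Or.inr (Or.inr ⟨r, rfl, h1⟩), h2⟩
      · rintro ⟨s, ⟨r, rfl, rfl⟩ | ⟨rfl, rfl⟩ | ⟨e', rfl, h1⟩, h2⟩
        · rcases hp.1 h2 with ⟨d', rfl, rfl⟩ | ⟨rfl, rfl⟩ | ⟨e', rfl, h⟩
          · exact Or.inl ⟨d', add_assoc _ _ _, rfl⟩
          · exact Or.inr (Or.inl ⟨rfl, rfl⟩)
          · exact Or.inr (Or.inr ⟨e', add_assoc _ _ _, h⟩)
        · exact Or.inr (Or.inr ⟨d₂, rfl, ht.1 h2⟩)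
        · exact Or.inr (Or.inr ⟨e' + d₂, (add_assoc _ _ _).symm, (ih _ _ _).2 ⟨s, h1, h2⟩⟩)

theorem testEnv_isEnvironment {Y : TIOTS.{u, v} Act} (hI : Y.I = X.I) (hO : Y.O = X.O) :
    IsEnvironment (testEnv X f hf b w) Y :=
  ⟨testEnv_timeAdditive, hI, hO⟩

/-- The completion of a test adds only transitions to `⊤`. -/
theorem testEnv_completion_step {v : List (TimedAction B)} {α : TimedAction Act}
    {s : TState (List (TimedAction B))} (hs : s ≠ TState.top)
    (h : (testEnv X f hf b w).completion.Tr (TState.plain v) α s) :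
    (testEnv X f hf b w).step v α s := by
  rcases tr_plain.1 h with (h | ⟨-, ⟨a, ha, rfl⟩, h⟩) | ⟨h, -⟩
  · exact h
  · exact absurd ⟨TState.top, Or.inr (Or.inl ⟨a, ha, rfl, rfl⟩)⟩ h
  · exact absurd h hs

/-- A test for `w` performs `w`. -/
theorem testEnv_admits (v : List (TimedAction B)) :
    (testEnv X f hf b w).completion.Admits (!b) (testState b v) (v.map (decode f)) := by
  induction v with
  | nil => cases b <;> simp [testState, Admits, Final]
  | cons α v ih =>
    refine ⟨testState b v, Tr.plain _ _ _ (Or.inl (Or.inl ?_)), ih⟩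
    cases α with
    | act c => exact Or.inr (Or.inr ⟨c, v, rfl, rfl, rfl⟩)
    | delay d => exact Or.inl ⟨d, rfl, Or.inr (Or.inl ⟨rfl, rfl⟩)⟩

theorem completion_tr_delay {s t : TState X.P} {d : {d : ℝ // 0 < d}} (ht : t ≠ TState.top) :
    X.completion.Tr s (TimedAction.delay d) t ↔ X.Tr s (TimedAction.delay d) t := by
  cases s with
  | top => exact iff_of_false (fun h => ht h.eq_top) fun h => ht h.eq_top
  | bot =>
    exact (tr_bot (X := X.completion)).trans
      ((and_congr_left' (iff_of_true (delay_mem_tA _ _) (delay_mem_tA _ _))).trans tr_bot.symm)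
  | plain p =>
    refine (tr_plain (X := X.completion)).trans (Iff.trans ?_ tr_plain.symm)
    constructor
    · rintro ((h | ⟨-, ⟨a, -, h⟩, -⟩) | ⟨h, -⟩)
      · exact h
      · cases h
      · exact absurd h ht
    · exact fun h => Or.inl (Or.inl h)

/-- Time additivity passes to the completion as far as runs that avoid `⊤` are concerned. -/
theorem TimeAdditive.completion_tr (hX : X.TimeAdditive) {s t : TState X.P}
    {d₁ d₂ : {d : ℝ // 0 < d}} (ht : t ≠ TState.top) :
    X.completion.Tr s (TimedAction.delay (d₁ + d₂)) t ↔
      ∃ m, X.completion.Tr s (TimedAction.delay d₁) m ∧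
        X.completion.Tr m (TimedAction.delay d₂) t := by
  have hm : ∀ {m}, X.completion.Tr m (TimedAction.delay d₂) t → m ≠ TState.top := by
    rintro m h rfl
    exact ht h.eq_top
  have key : X.Tr s (TimedAction.delay (d₁ + d₂)) t ↔
      ∃ m, X.Tr s (TimedAction.delay d₁) m ∧ X.Tr m (TimedAction.delay d₂) t := by
    cases s with
    | top =>
      refine iff_of_false (fun h => ht h.eq_top) ?_
      rintro ⟨m, h1, h2⟩
      cases h1.eq_top
      exact ht h2.eq_top
    | bot =>
      constructor
      · intro h
        cases (tr_bot.1 h).2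
        exact ⟨TState.bot, tr_bot.2 ⟨delay_mem_tA _ _, rfl⟩, tr_bot.2 ⟨delay_mem_tA _ _, rfl⟩⟩
      · rintro ⟨m, h1, h2⟩
        cases (tr_bot.1 h1).2
        cases (tr_bot.1 h2).2
        exact tr_bot.2 ⟨delay_mem_tA _ _, rfl⟩
    | plain p => exact hX p d₁ d₂ t
  rw [completion_tr_delay ht, key]
  constructor
  · rintro ⟨m, h1, h2⟩
    have h2 := (completion_tr_delay ht).2 h2
    exact ⟨m, (completion_tr_delay (X := X) (hm h2)).2 h1, h2⟩
  · rintro ⟨m, h1, h2⟩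
    exact ⟨m, (completion_tr_delay (X := X) (hm h2)).1 h1, (completion_tr_delay ht).1 h2⟩

/-- If a test allows the delay `e` and `X` can follow it, then `X` can follow the word that the
test had to perform before, up to the division of delays, which a time-additive `X` does not
observe. -/
theorem TimeAdditive.admits_of_testDelay (hX : X.TimeAdditive) {s : TState (List (TimedAction B))} :
    ∀ {v : List (TimedAction B)} {e : {d : ℝ // 0 < d}} {x y : TState X.P}, testDelay b v e s →
      X.completion.Tr x (TimedAction.delay e) y →
      X.completion.Admits b y ((remaining s).map (decode f)) →
      X.completion.Admits b x (v.map (decode f)) := by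
  intro v
  induction v with
  | nil =>
    rintro e x y ⟨rfl, rfl⟩ h hy
    exact final_true (Tr.ne_top (X := X.completion) h (Admits.ne_top (X := X.completion) hy))
  | cons α v ih =>
    intro e x y hs h hy
    cases α with
    | act c => exact hs.elim
    | delay d =>
      rcases hs with ⟨d', rfl, rfl⟩ | ⟨rfl, rfl⟩ | ⟨e', rfl, hs⟩
      · obtain ⟨z, h', hz⟩ := hy
        exact ⟨z, (hX.completion_tr (Admits.ne_top (X := X.completion) hz)).2 ⟨y, h, h'⟩, hz⟩
      · rw [remaining_testState] at hy
        exact ⟨y, h, hy⟩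
      · obtain ⟨m, h1, h2⟩ := (hX.completion_tr (Admits.ne_top (X := X.completion) hy)).1 h
        exact ⟨m, h1, ih hs h2 hy⟩

/-- If a run of a test together with `X` ends in `⊥` on one side and not in `⊤` on the other,
then `X` admits the word that the test had to perform. -/
theorem TimeAdditive.admits_remaining (hX : X.TimeAdditive) {Y : TIOTS.{u, v} Act}
    (hY : Y.A = X.A) {hf : ∀ c, f c ∈ Y.A} {c c' : Bool}
    (hc : c = false ∨ c' = false) {u : List (TimedAction Act)} :
    ∀ {x : TState X.P} {s : TState (List (TimedAction B))},
      (s = TState.bot → b = true) → X.completion.Admits c x u →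
      (testEnv Y f hf b w).completion.Admits c' s u →
      X.completion.Admits b x ((remaining s).map (decode f)) := by
  induction u with
  | nil =>
    intro x s hb hx hs
    cases s with
    | top => exact hs.elim
    | bot =>
      obtain rfl := hb rfl
      exact final_true (Admits.ne_top (X := X.completion) hx)
    | plain v =>
      have hc : c = false := by
        rcases hc with hc | rfl
        · exact hc
        · cases hs
      subst hc
      cases x with
      | top => exact hx.elim
      | plain p => cases hx
      | bot =>
        refine admits_bot (X := X.completion) fun α hα => ?_
        obtain ⟨β, -, rfl⟩ := List.mem_map.1 hα
        cases β with
        | delay d => exact delay_mem_tA _ d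
        | act a =>
          rintro _ ⟨⟩
          exact hY ▸ hf a
  | cons α u ih =>
    rintro x s hb ⟨y, hxy, hy⟩ ⟨s', hss, hs'⟩
    cases s with
    | top => exact absurd rfl (hss.ne_top (Admits.ne_top hs'))
    | bot =>
      obtain rfl := hb rfl
      exact final_true (Tr.ne_top (X := X.completion) hxy (Admits.ne_top (X := X.completion) hy))
    | plain v =>
      have hstep := testEnv_completion_step (Admits.ne_top hs') hss
      rcases hstep with ⟨e, rfl, hd⟩ | ⟨a, -, -, h⟩ | ⟨a, v', rfl, rfl, rfl⟩
      · refine hX.admits_of_testDelay hd hxy (ih ?_ hy hs')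
        rintro rfl
        -- A delay leads a test to `⊥` only if `b = true`.
        clear * - hd
        induction v generalizing e with
        | nil => exact hd.1
        | cons β v ih =>
          cases β with
          | act c => exact hd.elim
          | delay d =>
            rcases hd with ⟨d', -, h⟩ | ⟨-, h⟩ | ⟨e', -, h⟩
            · cases h
            · cases v <;> cases b <;> first | rfl | cases h
            · exact ih _ h
      · exact absurd h (Admits.ne_top hs')
      · refine ⟨y, hxy, ?_⟩
        have := ih ?_ hy hs'
        · rwa [remaining_testState] at this
        · cases v' <;> cases b <;> simp [testState]

/-- Every word uses only finitely many actions, which can be encoded in any universe. -/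
theorem exists_decode {S : Set Act} {w : List (TimedAction Act)}
    (hw : ∀ α ∈ w, ∀ a, α = TimedAction.act a → a ∈ S) :
    ∃ (B : Type u) (f : B → Act) (v : List (TimedAction B)),
      (∀ c, f c ∈ S) ∧ v.map (decode f) = w := by
  induction w with
  | nil => exact ⟨PEmpty, PEmpty.elim, [], fun c => c.elim, rfl⟩
  | cons α w ih =>
    obtain ⟨B, f, v, hf, hv⟩ := ih fun β hβ => hw β (by simp [hβ])
    cases α with
    | delay d => exact ⟨B, f, TimedAction.delay d :: v, hf, by simp [decode, hv]⟩
    | act a =>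
      refine ⟨Option B, fun c => c.elim a f,
        TimedAction.act none :: v.map (decode some), ?_, ?_⟩
      · rintro (_ | c)
        · exact hw _ (by simp) a rfl
        · exact hf c
      · have : (decode fun c : Option B => c.elim a f) ∘ decode some = decode f := by
          funext β
          cases β <;> rfl
        rw [List.map_cons, List.map_map, this, hv]
        rfl

end Test

/-! ### Refinement and equivalence -/

section Refinement

variable {X Y E : TIOTS.{u, v} Act}

theorem reachable_bot_iff :
    ∀ s : TState X.P, Relation.ReflTransGen (fun s s' => ∃ α, X.Tr s α s') s TState.bot ↔
      ∃ w, X.Admits false s w := by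
  intro s
  constructor
  · intro h
    induction h using Relation.ReflTransGen.head_induction_on with
    | refl => exact ⟨[], True.intro⟩
    | head h _ ih =>
      obtain ⟨α, h⟩ := h
      obtain ⟨w, hw⟩ := ih
      exact ⟨α :: w, _, h, hw⟩
  · rintro ⟨w, hw⟩
    induction w generalizing s with
    | nil =>
      cases s with
      | top => exact hw.elim
      | bot => exact Relation.ReflTransGen.refl
      | plain p => cases hw
    | cons α w ih =>
      obtain ⟨t, h, hw⟩ := hw
      exact Relation.ReflTransGen.head ⟨α, h⟩ (ih t hw)

theorem Tr.completion {s t : TState X.P} {α : TimedAction Act} (h : X.Tr s α t) :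
    X.completion.Tr s α t := by
  cases h with
  | top d => exact Tr.top d
  | bot α h => exact Tr.bot (X := X.completion) α h
  | plain p α _ h => exact Tr.plain (X := X.completion) p α _ (Or.inl (Or.inl h))

theorem Admits.completion {b : Bool} {w : List (TimedAction Act)} :
    ∀ {s : TState X.P}, X.Admits b s w → X.completion.Admits b s w := by
  induction w with
  | nil => exact fun h => h
  | cons α w ih =>
    rintro s ⟨t, h, hw⟩
    exact ⟨t, h.completion, ih hw⟩

/-- Runs of a parallel composition never leave a pair for a state of one operand alone, so its
completion adds no words from combined states. -/
theorem admits_par_of_completion {h : Composable Op.par X E} {b : Bool}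
    {w : List (TimedAction Act)} :
    ∀ (s₀ : TState X.P) (s₁ : TState E.P),
      (comp Op.par X E h).completion.Admits b (combine Op.par s₀ s₁) w →
      (comp Op.par X E h).Admits b (combine Op.par s₀ s₁) w := by
  induction w with
  | nil => exact fun _ _ => id
  | cons α w ih =>
    intro s₀ s₁ hw
    have hA := Admits.mem_tA (X := (comp Op.par X E h).completion) hw
    have hbot := admits_bot (X := comp Op.par X E h) (b := b) hA
    have htop := fun hw => not_admits_top (X := (comp Op.par X E h).completion) (b := b)
      (w := α :: w) hw
    cases s₀ with
    | top => exact (htop hw).elim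
    | bot =>
      cases s₁ with
      | top => exact (htop hw).elim
      | bot => exact hbot
      | plain q => exact hbot
    | plain p =>
      cases s₁ with
      | top => exact (htop hw).elim
      | bot => exact hbot
      | plain q =>
        have hα : α ∈ (comp Op.par X E h).tA := hA α (by simp)
        obtain ⟨t, ht, hw⟩ := hw
        obtain ⟨t₀, t₁, h0, h1, rfl⟩ := (comp_tr_pair hα).1 ht
        exact ⟨_, Tr.plain _ _ _ ((compStep_pair (mem_or_of_mem_comp_tA hα)).2
          ⟨t₀, t₁, h0, h1, rfl⟩), ih _ _ hw⟩

/-- `X ∥ E` is `⊥`-free unless some word leads one of `X` and `E` to `⊥` and the other one to a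
state other than `⊤`. -/
theorem botFree_iff (hE : IsEnvironment E X) :
    (comp Op.par X E hE.composable).BotFree ↔
      ¬ ∃ w, X.completion.Admits false X.init w ∧ E.completion.Admits true E.init w ∨
        X.completion.Admits true X.init w ∧ E.completion.Admits false E.init w := by
  have hXE : X.tA = E.tA := by
    simp only [tA, A, hE.I_eq, hE.O_eq, Set.union_comm]
  have hpar : ∀ {α}, α ∈ X.tA → α ∈ (comp Op.par X E hE.composable).tA := by
    intro α hα a ha
    exact mem_comp_of_mem Op.par X E hE.composable a (Or.inl (hα a ha))
  refine not_congr ((reachable_bot_iff _).trans ⟨?_, ?_⟩)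
  · rintro ⟨w, hw⟩
    have hw := Admits.completion hw
    have hA := Admits.mem_tA (X := (comp Op.par X E hE.composable).completion) hw
    rcases (admits_par hA X.init E.init).1 hw with ⟨u, -, hu⟩ | ⟨⟨⟩, -⟩
    have hp : X.proj u = E.proj u := proj_congr hXE u
    refine ⟨X.proj u, ?_⟩
    rw [hp]
    rw [Allows, Allows, Allows, Allows, hp] at hu
    exact hu
  · rintro ⟨w, hw⟩
    have hA : ∀ α ∈ w, α ∈ X.tA := by
      rcases hw with hw | hw
      · exact Admits.mem_tA (X := X.completion) hw.1
      · exact Admits.mem_tA (X := X.completion) hw.1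
    refine ⟨w, admits_par_of_completion X.init E.init
      ((admits_par (fun α hα => hpar (hA α hα)) X.init E.init).2 (Or.inl ⟨w, by simp, ?_⟩))⟩
    rw [allows_iff_admits hA, allows_iff_admits hA, allows_iff_admits (hXE ▸ hA),
      allows_iff_admits (hXE ▸ hA)]
    exact hw

/-- The words admitted by (the completion of) an implementation are admitted by the specification,
provided that the latter is time-additive: a word is detected by the environment that performs
just this word, and for `b = true` fails at its end. -/
theorem Refines.admits (h : Refines X Y) (hX : X.TimeAdditive) {b : Bool}
    {w : List (TimedAction Act)} (hw : Y.completion.Admits b Y.init w) :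
    X.completion.Admits b X.init w := by
  obtain ⟨⟨hI, hO⟩, h⟩ := h
  obtain ⟨B, f, v, hf, rfl⟩ := exists_decode.{u} (S := Y.A)
    (Admits.mem_tA (X := Y.completion) hw)
  have hEX : IsEnvironment (testEnv Y f hf b v) X := testEnv_isEnvironment hI hO
  have hEY : IsEnvironment (testEnv Y f hf b v) Y := testEnv_isEnvironment rfl rfl
  have h := mt (h _ hEX hEY)
  rw [botFree_iff hEX, botFree_iff hEY, not_not, not_not] at h
  have hA : Y.A = X.A := by simp only [A, hI, hO]
  have hE : (testEnv Y f hf b v).completion.Admits (!b) (testEnv Y f hf b v).init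
      (v.map (decode f)) := testEnv_admits v
  have hb : testState b v = TState.bot → b = true := by
    cases v <;> cases b <;> simp [testState]
  have key : X.completion.Admits b X.init ((remaining (testState b v)).map (decode f)) := by
    obtain ⟨u, ⟨h1, h2⟩ | ⟨h1, h2⟩⟩ := h ⟨v.map (decode f), by
      cases b
      · exact Or.inl ⟨hw, hE⟩
      · exact Or.inr ⟨hw, hE⟩⟩
    · exact hX.admits_remaining hA (Or.inl rfl) hb h1 h2
    · exact hX.admits_remaining hA (Or.inr rfl) hb h1 h2
  rwa [remaining_testState] at key

theorem SubstEquiv.allows_eq (h : SubstEquiv X Y) (hX : X.TimeAdditive) (hY : Y.TimeAdditive)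
    (b : Bool) : X.Allows b X.init = Y.Allows b Y.init := by
  funext w
  have hp : X.proj w = Y.proj w := proj_congr (tA_congr h.1.1.1 h.1.1.2) w
  rw [Allows, Allows, hp]
  exact propext ⟨h.2.admits hY, h.1.admits hX⟩

theorem SubstEquiv.of_admits (hI : X.I = Y.I) (hO : X.O = Y.O)
    (h : ∀ b w, X.completion.Admits b X.init w ↔ Y.completion.Admits b Y.init w) :
    SubstEquiv X Y := by
  constructor
  · refine ⟨⟨hI, hO⟩, fun E hX hY hE => ?_⟩
    rw [botFree_iff hX] at hE
    rw [botFree_iff hY]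
    simpa only [h] using hE
  · refine ⟨⟨hI.symm, hO.symm⟩, fun E hX hY hE => ?_⟩
    rw [botFree_iff hX] at hE
    rw [botFree_iff hY]
    simpa only [h] using hE

theorem SubstEquiv.comp {op : Op} {X' Y' : TIOTS.{u, v} Act} (hX : X.TimeAdditive)
    (hX' : X'.TimeAdditive) (hY : Y.TimeAdditive) (hY' : Y'.TimeAdditive)
    (h : Composable op X Y) (h' : Composable op X' Y') (h₀ : SubstEquiv X X')
    (h₁ : SubstEquiv Y Y') : SubstEquiv (comp op X Y h) (comp op X' Y' h') := by
  obtain ⟨hI₀, hO₀⟩ := h₀.1.1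
  obtain ⟨hI₁, hO₁⟩ := h₁.1.1
  have hI : (TIOTS.comp op X Y h).I = (TIOTS.comp op X' Y' h').I := by
    cases op <;> simp only [TIOTS.comp, compI, hI₀, hO₀, hI₁, hO₁]
  have hO : (TIOTS.comp op X Y h).O = (TIOTS.comp op X' Y' h').O := by
    cases op <;> simp only [TIOTS.comp, compO, hO₀, hO₁]
  have hA := tA_congr hI hO
  have e₀ := h₀.allows_eq hX hX'
  have e₁ := h₁.allows_eq hY hY'
  refine SubstEquiv.of_admits hI hO fun b w => ?_
  by_cases hw : ∀ α ∈ w, α ∈ (TIOTS.comp op X Y h).tA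
  · have hw' : ∀ α ∈ w, α ∈ (TIOTS.comp op X' Y' h').tA := hA ▸ hw
    cases op
    · refine (admits_par hw X.init Y.init).trans
        (Iff.trans ?_ (admits_par hw' X'.init Y'.init).symm)
      rw [e₀, e₀, e₁, e₁]
    · refine (admits_conj hw X.init Y.init).trans
        (Iff.trans ?_ (admits_conj hw' X'.init Y'.init).symm)
      rw [e₀, e₁]
    · refine (admits_disj hw X.init Y.init).trans
        (Iff.trans ?_ (admits_disj hw' X'.init Y'.init).symm)
      rw [e₀, e₁]
    · refine (admits_quot hw X.init Y.init).trans
        (Iff.trans ?_ (admits_quot hw' X'.init Y'.init).symm)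
      rw [e₀, e₀, e₁, e₁]
  · refine iff_of_false (fun ha => hw (Admits.mem_tA (X := (TIOTS.comp op X Y h).completion) ha))
      fun ha => hw ?_
    rw [hA]
    exact Admits.mem_tA (X := (TIOTS.comp op X' Y' h').completion) ha

theorem Refines.trans {Z : TIOTS.{u, v} Act} (h : Refines X Y) (h' : Refines Y Z) :
    Refines X Z := by
  refine ⟨⟨h.1.1.trans h'.1.1, h.1.2.trans h'.1.2⟩, fun E hX hZ hE => ?_⟩
  have hY : IsEnvironment E Y := ⟨hX.additive, h.1.1.symm.trans hX.I_eq, h.1.2.symm.trans hX.O_eq⟩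
  exact h'.2 E hY hZ (h.2 E hX hY hE)

theorem substEquiv_equivalence :
    Equivalence (SubstEquiv : TIOTS.{u, v} Act → TIOTS.{u, v} Act → Prop) where
  refl _ := ⟨⟨⟨rfl, rfl⟩, fun _ _ _ => id⟩, ⟨rfl, rfl⟩, fun _ _ _ => id⟩
  symm h := ⟨h.2, h.1⟩
  trans h h' := ⟨h.1.trans h'.1, h'.2.trans h.2⟩

end Refinement

end TIOTS

theorem mainTheorem3 {Act : Type v} :
    Equivalence (TIOTS.SubstEquiv : TIOTS.{u, v} Act → TIOTS.{u, v} Act → Prop) ∧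
    ∀ (op : TIOTS.Op) (P₀ P₀' P₁ P₁' : TIOTS.{u, v} Act),
      P₀.TimeAdditive → P₀'.TimeAdditive → P₁.TimeAdditive → P₁'.TimeAdditive →
      ∀ (h : TIOTS.Composable op P₀ P₁) (h' : TIOTS.Composable op P₀' P₁'),
        TIOTS.SubstEquiv P₀ P₀' → TIOTS.SubstEquiv P₁ P₁' →
          TIOTS.SubstEquiv (TIOTS.comp op P₀ P₁ h) (TIOTS.comp op P₀' P₁' h') := by
  exact ⟨TIOTS.substEquiv_equivalence, fun _ _ _ _ _ a₀ a₀' a₁ a₁' h h' h₀ h₁ =>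
    TIOTS.SubstEquiv.comp a₀ a₀' a₁ a₁' h h' h₀ h₁⟩
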